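/- Let $m,n\ge 1$ with $m$ odd. A real tensor of order $m$ and dimension $n$ is an array $\mathcal T=(t_{i_1\cdots i_m})$ of real numbers, $i_1,\dots,i_m\in[n]=\{1,\dots,n\}$; its diagonal entries are the $t_{ii\cdots i}$, and $|\mathcal T|=(|t_{i_1\cdots i_m}|)$. A real number $\mu$ is an H-eigenvalue of $\mathcal T$ if there is a nonzero $x\in\mathbb R^n$ with $$\sum_{i_2,\dots,i_m=1}^n t_{i i_2\cdots i_m}x_{i_2}\cdots x_{i_m}=\mu\, x_i^{m-1}\qquad\text{for all } i\in[n],$$ and $\lambda(\mathcal T)$ denotes the largest H-eigenvalue of $\mathcal T$. Let $\mathcal A=\mathcal D-\mathcal C$ be a tensor of order $m$ and dimension $n$, where $\mathcal D$ is a diagonal tensor (all off-diagonal entries are zero) with nonnegative entries, and $\mathcal C=(c_{i_1\cdots i_m})$ is a tensor with nonnegative entries whose diagonal entries are all zero. Suppose that $V\subset[n]$ is a nonempty proper subset with respect to which $\mathcal C$ is weakly odd-bipartite, i.e. $c_{i_1\cdots i_m}=0$ whenever the number of positions $j\in[m]$ with $i_j\in V$ is even, and that $c_{i i_2\cdots i_m}=0$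 for all $i\in V$ and all $i_2,\dots,i_m\in[n]$. If $\mathcal A$ and $|\mathcal A|$ have H-eigenvalues, then both have a largest H-eigenvalue and $$\lambda(\mathcal A)=\lambda(|\mathcal A|).$$ Moreover, if $m\ge 3$, then $\mathcal A$ and $|\mathcal A|$ always have H-eigenvalues. -/

import Mathlib

/-- Real tensors of order `m` and dimension `n`, given by their entries. -/
abbrev RTensor (m n : ℕ) : Type := (Fin m → Fin n) → ℝ

namespace RTensor

variable {m n : ℕ}

/-- The absolute tensor, obtained by taking the absolute value of every entry. -/
def absTensor (T : RTensor m n) : RTensor m n := fun idx => |T idx|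

/-- A multi-index is diagonal if all its components coincide. -/
def DiagIndex (idx : Fin m → Fin n) : Prop := ∃ i, ∀ j, idx j = i

/-- Entrywise nonnegative tensors. -/
def Nonneg (T : RTensor m n) : Prop := ∀ idx, 0 ≤ T idx

/-- Diagonal tensors: all off-diagonal entries vanish. -/
def IsDiagonal (T : RTensor m n) : Prop := ∀ idx, ¬ DiagIndex idx → T idx = 0

/-- Tensors all of whose diagonal entries vanish. -/
def ZeroDiagonal (T : RTensor m n) : Prop := ∀ idx, DiagIndex idx → T idx = 0

/-- The vector `T x^(m-1)`: its `i`-th component is the sum, over all multi-indices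
`(i₁, …, iₘ)` with first index `i₁ = i`, of `T (i₁, …, iₘ) * x i₂ * ⋯ * x iₘ`. -/
def applyVec [NeZero m] (T : RTensor m n) (x : Fin n → ℝ) (i : Fin n) : ℝ :=
  ∑ idx : Fin m → Fin n with idx 0 = i, T idx * ∏ j ∈ Finset.univ.erase (0 : Fin m), x (idx j)

/-- `μ` is an H-eigenvalue of `T`: some nonzero real `x` satisfies `T x^(m-1) = μ x^[m-1]`. -/
def IsHEigenvalue [NeZero m] (T : RTensor m n) (μ : ℝ) : Prop :=
  ∃ x : Fin n → ℝ, x ≠ 0 ∧ ∀ i, T.applyVec x i = μ * x i ^ (m - 1)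

/-- The set of H-eigenvalues of `T`. -/
def hEigenvalues [NeZero m] (T : RTensor m n) : Set ℝ := {μ | T.IsHEigenvalue μ}

/-- `T` is weakly odd-bipartite with respect to `V`: `V` is a nonempty proper set of indices and
an entry of `T` vanishes whenever the number of its indices in `V`, counted with repetition,
is even. -/
def WeaklyOddBipartite (T : RTensor m n) (V : Finset (Fin n)) : Prop :=
  V.Nonempty ∧ V ≠ Finset.univ ∧
    ∀ idx : Fin m → Fin n, Even (Finset.card {j : Fin m | idx j ∈ V}) → T idx = 0

end RTensor

/-!
Order the indices so that `V` comes before its complement. Every nonzero off-diagonal entry of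
`D - C` has its first index outside `V` and some other index in `V`, so at an index of the support
of an eigenvector that is minimal for this order only the diagonal term of the eigenvalue equation
survives. Hence every H-eigenvalue is a diagonal entry. Conversely, since `m - 1` is even, the
entries `c_{ik⋯k}` vanish, and for `m ≥ 3` each standard basis vector is an eigenvector. Both
arguments only see the zero pattern and the diagonal, which `D - C` and its absolute tensor share.
For `m = 1` the two tensors are equal.
-/

namespace RTensor

variable {m n : ℕ} {α : Type*} [Preorder α]

/-- The diagonal of a tensor, as a vector. -/
def diag (T : RTensor m n) (i : Fin n) : ℝ := T fun _ => i

/-- `T` is triangular with respect to the rank `r` if every nonzero off-diagonal entry has an index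
of rank strictly smaller than that of its first index. For `m = 2` and injective `r` with values in
a linear order, this says that `T` is a lower triangular matrix when the indices are sorted
by `r`. -/
def IsTriangular [NeZero m] (T : RTensor m n) (r : Fin n → α) : Prop :=
  ∀ idx, ¬ DiagIndex idx → T idx ≠ 0 → ∃ j, r (idx j) < r (idx 0)

/-- The off-diagonal entries `t_{ik⋯k}` of `T` vanish. For `m ≥ 2` this says that the majorization
matrix `(t_{ik⋯k})` of `T` is diagonal; for `m = 1` there is no off-diagonal entry. -/
def HasDiagonalMajorization [NeZero m] (T : RTensor m n) : Prop :=
  ∀ idx, ¬ DiagIndex idx → ∀ k, (∀ j ≠ 0, idx j = k) → T idx = 0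

lemma diagIndex_of_eq_one (hm : m = 1) (idx : Fin m → Fin n) : DiagIndex idx := by
  subst hm
  exact ⟨idx 0, fun j => congrArg idx (Subsingleton.elim j 0)⟩

section AbsTensor

variable {T : RTensor m n}

lemma diag_absTensor (hT : ∀ i, 0 ≤ T.diag i) : T.absTensor.diag = T.diag :=
  funext fun i => abs_of_nonneg (hT i)

lemma absTensor_eq_self_of_eq_one (hm : m = 1) (hT : ∀ i, 0 ≤ T.diag i) : T.absTensor = T := by
  ext idx
  obtain ⟨i, hi⟩ := diagIndex_of_eq_one hm idx
  obtain rfl : idx = fun _ => i := funext hi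
  exact abs_of_nonneg (hT i)

lemma IsTriangular.absTensor [NeZero m] {r : Fin n → α} (hT : T.IsTriangular r) :
    T.absTensor.IsTriangular r :=
  fun idx hidx h => hT idx hidx (abs_ne_zero.1 h)

lemma HasDiagonalMajorization.absTensor [NeZero m] (hT : T.HasDiagonalMajorization) :
    T.absTensor.HasDiagonalMajorization :=
  fun idx hidx k hk => abs_eq_zero.2 (hT idx hidx k hk)

end AbsTensor

section Spectrum

variable [NeZero m] {T : RTensor m n}

lemma applyVec_eq_diag_mul_pow {x : Fin n → ℝ} {i : Fin n}
    (h : ∀ idx : Fin m → Fin n, idx 0 = i → ¬ DiagIndex idx →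
      T idx * ∏ j ∈ Finset.univ.erase (0 : Fin m), x (idx j) = 0) :
    T.applyVec x i = T.diag i * x i ^ (m - 1) := by
  have hoff : ∀ idx ∈ Finset.univ.filter fun idx : Fin m → Fin n => idx 0 = i,
      idx ≠ (fun _ => i) → T idx * ∏ j ∈ Finset.univ.erase (0 : Fin m), x (idx j) = 0 := by
    intro idx hidx hne
    have h0 : idx 0 = i := (Finset.mem_filter.1 hidx).2
    exact h idx h0 fun ⟨k, hk⟩ => hne (funext fun j => (hk j).trans ((hk 0).symm.trans h0))
  rw [applyVec, Finset.sum_eq_single_of_mem (fun _ => i) (by simp) hoff]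
  simp [diag]

lemma IsTriangular.mem_range_diag {r : Fin n → α} (hT : T.IsTriangular r) {μ : ℝ}
    (hμ : T.IsHEigenvalue μ) : μ ∈ Set.range T.diag := by
  obtain ⟨x, hx, hxμ⟩ := hμ
  obtain ⟨i, hi, hmin⟩ :=
    (Set.toFinite {i | x i ≠ 0}).exists_minimalFor r _ (Function.ne_iff.1 hx)
  have hsmall : ∀ k, r k < r i → x k = 0 := fun k hk =>
    by_contra fun hxk => hk.not_ge (hmin hxk hk.le)
  have happly : T.applyVec x i = T.diag i * x i ^ (m - 1) := by
    refine applyVec_eq_diag_mul_pow fun idx h0 hidx => ?_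
    by_cases hTidx : T idx = 0
    · rw [hTidx, zero_mul]
    obtain ⟨j, hj⟩ := hT idx hidx hTidx
    have hj0 : j ≠ 0 := by rintro rfl; exact lt_irrefl _ hj
    have hxj : x (idx j) = 0 := hsmall _ (h0 ▸ hj)
    rw [Finset.prod_eq_zero (Finset.mem_erase.2 ⟨hj0, Finset.mem_univ j⟩) hxj, mul_zero]
  exact ⟨i, mul_right_cancel₀ (pow_ne_zero _ hi) (happly.symm.trans (hxμ i))⟩

lemma IsTriangular.finite_hEigenvalues {r : Fin n → α} (hT : T.IsTriangular r) :
    T.hEigenvalues.Finite :=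
  (Set.finite_range T.diag).subset fun _ => hT.mem_range_diag

lemma HasDiagonalMajorization.isHEigenvalue_diag (hm : 2 ≤ m) (hT : T.HasDiagonalMajorization)
    (k : Fin n) : T.IsHEigenvalue (T.diag k) := by
  refine ⟨Pi.single k 1, by simp, fun i => ?_⟩
  rw [applyVec_eq_diag_mul_pow fun idx _ hidx => ?_]
  · obtain rfl | hik := eq_or_ne i k
    · rfl
    · rw [Pi.single_eq_of_ne hik, zero_pow (by omega), mul_zero, mul_zero]
  · by_cases hk : ∀ j ≠ 0, idx j = k
    · rw [hT idx hidx k hk, zero_mul]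
    · push Not at hk
      obtain ⟨j, hj0, hjk⟩ := hk
      rw [Finset.prod_eq_zero (by simpa using hj0) (Pi.single_eq_of_ne hjk 1), mul_zero]

lemma hEigenvalues_eq_range_diag (hm : 2 ≤ m) {r : Fin n → α} (htri : T.IsTriangular r)
    (hmaj : T.HasDiagonalMajorization) : T.hEigenvalues = Set.range T.diag :=
  Set.Subset.antisymm (fun _ => htri.mem_range_diag)
    (Set.range_subset_iff.2 (hmaj.isHEigenvalue_diag hm))

lemma hEigenvalues_absTensor {r : Fin n → α} (htri : T.IsTriangular r)
    (hmaj : T.HasDiagonalMajorization) (hdiag : ∀ i, 0 ≤ T.diag i) :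
    T.absTensor.hEigenvalues = T.hEigenvalues := by
  obtain hm | hm : m = 1 ∨ 2 ≤ m := by have := NeZero.pos m; omega
  · rw [absTensor_eq_self_of_eq_one hm hdiag]
  · rw [hEigenvalues_eq_range_diag hm htri hmaj, ← diag_absTensor hdiag]
    exact hEigenvalues_eq_range_diag hm htri.absTensor hmaj.absTensor

end Spectrum

section DiagonalPerturbation

variable {D C : RTensor m n}

lemma ZeroDiagonal.diag_sub (hC : C.ZeroDiagonal) : (D - C).diag = D.diag := by
  ext i
  simp [diag, hC (fun _ => i) ⟨i, fun _ => rfl⟩]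

lemma IsDiagonal.sub_apply_of_not_diagIndex (hD : D.IsDiagonal) {idx : Fin m → Fin n}
    (hidx : ¬ DiagIndex idx) : (D - C) idx = -C idx := by
  rw [Pi.sub_apply, hD idx hidx, zero_sub]

lemma IsTriangular.diagonal_sub [NeZero m] {r : Fin n → α} (hC : C.IsTriangular r)
    (hD : D.IsDiagonal) : (D - C).IsTriangular r := by
  intro idx hidx hne
  rw [hD.sub_apply_of_not_diagIndex hidx, neg_ne_zero] at hne
  exact hC idx hidx hne

lemma HasDiagonalMajorization.diagonal_sub [NeZero m] (hC : C.HasDiagonalMajorization)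
    (hD : D.IsDiagonal) : (D - C).HasDiagonalMajorization := by
  intro idx hidx k hk
  rw [hD.sub_apply_of_not_diagIndex hidx, hC idx hidx k hk, neg_zero]

end DiagonalPerturbation

section OddBipartite

variable [NeZero m] {C : RTensor m n} {V : Finset (Fin n)}

lemma zeroDiagonal_of_forall_notMem (hnone : ∀ idx : Fin m → Fin n, (∀ j, idx j ∉ V) → C idx = 0)
    (hslice : ∀ idx : Fin m → Fin n, idx 0 ∈ V → C idx = 0) : C.ZeroDiagonal := by
  rintro idx ⟨i, hi⟩
  by_cases hiV : i ∈ V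
  · exact hslice idx (by rwa [hi])
  · exact hnone idx fun j => by rwa [hi]

lemma isTriangular_of_forall_notMem
    (hnone : ∀ idx : Fin m → Fin n, (∀ j, idx j ∉ V) → C idx = 0)
    (hslice : ∀ idx : Fin m → Fin n, idx 0 ∈ V → C idx = 0) : C.IsTriangular (· ∉ V) := by
  intro idx _ hne
  have h0 : idx 0 ∉ V := mt (hslice idx) hne
  obtain ⟨j, hj⟩ : ∃ j, idx j ∈ V := by
    by_contra! hall
    exact hne (hnone idx hall)
  exact ⟨j, lt_iff_le_not_ge.2 ⟨fun _ => h0, fun hle => hle h0 hj⟩⟩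

lemma hasDiagonalMajorization_of_even_card (hm : Odd m)
    (heven : ∀ idx : Fin m → Fin n, Even (Finset.card {j : Fin m | idx j ∈ V}) → C idx = 0)
    (hslice : ∀ idx : Fin m → Fin n, idx 0 ∈ V → C idx = 0) : C.HasDiagonalMajorization := by
  intro idx _ k hk
  by_cases h0 : idx 0 ∈ V
  · exact hslice idx h0
  refine heven idx ?_
  have hmem : ∀ j, idx j ∈ V ↔ j ≠ 0 ∧ k ∈ V := fun j => by
    obtain rfl | hj := eq_or_ne j 0
    · simp [h0]
    · simp [hj, hk j hj]
  by_cases hkV : k ∈ V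
  · have hcount : (Finset.univ.filter fun j => idx j ∈ V) = Finset.univ.erase 0 := by
      ext j
      simp [hmem, hkV]
    simpa [hcount] using hm.tsub_odd odd_one
  · simp [hmem, hkV]

end OddBipartite

end RTensor

theorem mainTheorem7_general (m n : ℕ) [NeZero m] (hm : Odd m) (D C : RTensor m n)
    (hD : D.IsDiagonal) (hD0 : D.Nonneg) (V : Finset (Fin n))
    (heven : ∀ idx : Fin m → Fin n, Even (Finset.card {j : Fin m | idx j ∈ V}) → C idx = 0)
    (hslice : ∀ idx : Fin m → Fin n, idx 0 ∈ V → C idx = 0) :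
    (D - C).absTensor.hEigenvalues = (D - C).hEigenvalues ∧ (D - C).hEigenvalues.Finite ∧
      (3 ≤ m → (D - C).hEigenvalues = Set.range D.diag) := by
  have hnone : ∀ idx : Fin m → Fin n, (∀ j, idx j ∉ V) → C idx = 0 :=
    fun idx h => heven idx (by simp [h])
  have hdiag : (D - C).diag = D.diag :=
    (RTensor.zeroDiagonal_of_forall_notMem hnone hslice).diag_sub
  have htri := (RTensor.isTriangular_of_forall_notMem hnone hslice).diagonal_sub hD
  have hmaj := (RTensor.hasDiagonalMajorization_of_even_card hm heven hslice).diagonal_sub hD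
  refine ⟨RTensor.hEigenvalues_absTensor htri hmaj ?_, htri.finite_hEigenvalues, fun hm3 => ?_⟩
  · exact fun i => hdiag ▸ hD0 _
  · rw [RTensor.hEigenvalues_eq_range_diag (by omega) htri hmaj, hdiag]

theorem mainTheorem7 (m n : ℕ) [NeZero m] (hm : Odd m) (A D C : RTensor m n)
    (hD : D.IsDiagonal) (hD0 : D.Nonneg) (hC0 : C.Nonneg) (hCdiag : C.ZeroDiagonal)
    (hA : A = D - C) (V : Finset (Fin n)) (hV : C.WeaklyOddBipartite V)
    (hslice : ∀ idx : Fin m → Fin n, idx 0 ∈ V → C idx = 0) :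
    (A.hEigenvalues.Nonempty → A.absTensor.hEigenvalues.Nonempty →
      ∃ μ : ℝ, IsGreatest A.hEigenvalues μ ∧ IsGreatest A.absTensor.hEigenvalues μ) ∧
    (3 ≤ m → A.hEigenvalues.Nonempty ∧ A.absTensor.hEigenvalues.Nonempty) := by
  obtain ⟨habs, hfin, hrange⟩ := hA ▸ mainTheorem7_general m n hm D C hD hD0 V hV.2.2 hslice
  simp only [habs, and_self]
  exact ⟨fun hne _ => hfin.isCompact.exists_isGreatest hne,
    fun hm3 => hrange hm3 ▸ hV.1.elim fun k _ => ⟨_, k, rfl⟩⟩
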